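/- Let $n\ge 1$ and $k\ge 2$ be integers. For a permutation $\sigma$ of $\{1,\dots,n\}$ let $$C_\sigma=\{\beta\in\mathbb R^n:\ \beta_{\sigma(1)}\ge\beta_{\sigma(2)}\ge\dots\ge\beta_{\sigma(n)}\}$$ be the corresponding closed Weyl chamber of type $A_{n-1}$, and let $\mathcal F_k(C_\sigma)$ be the (finite) set of its $k$-dimensional faces, the dimension of a face being the dimension of its linear span. Let $L\subset\mathbb R^n$ be a linear subspace of codimension $d$ in general position with respect to the arrangement of the hyperplanes $\{\beta_i=\beta_j\}$, $1\le i<j\le n$; that is, for every linear subspace $K$ that is an intersection of some of these hyperplanes (the empty intersection being $\mathbb R^n$), $\dim(L\cap K)=\dim K-d$ if $\dim K\ge d$, and $\dim(L\cap K)=0$ if $\dim K\le d$. Then $$\frac1{n!}\sum_{\sigma\in\mathrm{Sym}(n)}\#\{F\in\mathcal F_k(C_\sigma):\ F\cap L=\{0\}\}=\frac{2}{k!}\binom{n-1}{k-1}\left(\left[{k\atop d-1}\right]+\left[{k\atop d-3}\right]+\cdots\right),$$ where the $\left[{k\atop j}\right]$ are the (unsigned) Stirling numbers of the first kind, defined by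 $t(t+1)\cdots(t+k-1)=\sum_{j=1}^{k}\left[{k\atop j}\right]t^j$, with $\left[{k\atop j}\right]=0$ for $j\le 0$ and for $j>k$. -/

import Mathlib

/-- The closed Weyl chamber of type `A_{n-1}` attached to a permutation `σ`:
all `β` with `β_{σ(1)} ≥ β_{σ(2)} ≥ … ≥ β_{σ(n)}`. -/
def weylChamberA {n : ℕ} (σ : Equiv.Perm (Fin n)) : PointedCone ℝ (Fin n → ℝ) where
  carrier := {β | ∀ i j : Fin n, i ≤ j → β (σ j) ≤ β (σ i)}
  add_mem' := fun ha hb i j hij => add_le_add (ha i j hij) (hb i j hij)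
  zero_mem' := fun _ _ _ => le_refl _
  smul_mem' := fun c _ hb i j hij => mul_le_mul_of_nonneg_left (hb i j hij) c.2

/-- The hyperplane `{β : β_i = β_j}` in `ℝⁿ`. -/
def equalCoordHyperplane {n : ℕ} (i j : Fin n) : Submodule ℝ (Fin n → ℝ) where
  carrier := {β | β i = β j}
  add_mem' := fun ha hb => congrArg₂ (· + ·) ha hb
  zero_mem' := rfl
  smul_mem' := fun c _ hb => congrArg (c * ·) hb

/-- The reflection (braid) arrangement of type `A_{n-1}`: all hyperplanes `{β_i = β_j}`, `i < j`. -/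
def reflectionArrangementA (n : ℕ) : Set (Submodule ℝ (Fin n → ℝ)) :=
  {H | ∃ i j : Fin n, i < j ∧ H = equalCoordHyperplane i j}

/-- The lattice generated by a set of hyperplanes: all intersections of some of them
(the empty intersection being the whole space). -/
def arrangementLattice {V : Type*} [AddCommGroup V] [Module ℝ V]
    (A : Set (Submodule ℝ V)) : Set (Submodule ℝ V) :=
  {K | ∃ S ⊆ A, K = sInf S}

/-- A linear subspace `L` of codimension `d` is in general position with respect to the
arrangement `A` if, for every `K` in the lattice of `A`, the dimension of `L ∩ K` is
`dim K - d` when `dim K ≥ d` and `0` when `dim K ≤ d`. -/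
def InGeneralPosition {V : Type*} [AddCommGroup V] [Module ℝ V]
    (A : Set (Submodule ℝ V)) (L : Submodule ℝ V) (d : ℕ) : Prop :=
  ∀ K ∈ arrangementLattice A,
    (d ≤ Module.finrank ℝ K → Module.finrank ℝ ↥(L ⊓ K) = Module.finrank ℝ K - d) ∧
    (Module.finrank ℝ K ≤ d → Module.finrank ℝ ↥(L ⊓ K) = 0)

/-- The set of `k`-dimensional faces of a convex cone `C`; the dimension of a face is the
dimension of its linear span. -/
def facesOfDim {V : Type*} [AddCommGroup V] [Module ℝ V]
    (k : ℕ) (C : PointedCone ℝ V) : Set (PointedCone ℝ V) :=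
  {F | F.IsFaceOf C ∧ Module.finrank ℝ (Submodule.span ℝ (F : Set V)) = k}

/-!
The `k`-dimensional faces of the chamber of `σ` are the cones `{γ ∘ f | γ antitone}`, one for each
surjection `f : Fin n → Fin k` with `f ∘ σ` monotone; there are `(n - 1).choose (k - 1)` of them.
Such a face meets `L` only in `0` exactly when the preimage of `L` under `γ ↦ γ ∘ f`, again a
generic subspace of codimension `d`, misses an open chamber of `ℝᵏ`. Permuting the levels of `f`
runs through all chambers of `ℝᵏ` and preserves the number of `σ` sorting `f`, so the average over
`σ` reduces to counting the chambers missed by a generic subspace.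

To count the chambers that a generic subspace of `ℝᵏ⁺¹` meets, insert the first coordinate into
the ordering of the other ones: along a line, the number of slabs between successive walls which
are met is one more than the number of walls which are met. This gives the recurrence of the
Stirling numbers of the first kind.
-/

open Finset Function

section Order

lemma exists_pos_strictMono_add_smul {ι : Type*} [LinearOrder ι] [Finite ι] {a b : ι → ℝ}
    (ha : Monotone a) (hb : ∀ ⦃i j⦄, i < j → a i = a j → b i < b j) :
    ∃ ε : ℝ, 0 < ε ∧ StrictMono (a + ε • b) := by
  have eventually_lt : ∀ᶠ ε in nhdsWithin (0 : ℝ) (Set.Ioi 0), ∀ p : ι × ι, p.1 < p.2 →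
      a p.1 + ε * b p.1 < a p.2 + ε * b p.2 := by
    refine Filter.eventually_all.2 fun ⟨i, j⟩ => Filter.eventually_imp_distrib_left.2 fun hij => ?_
    rcases (ha hij.le).lt_or_eq with hlt | heq
    · have tendsto_add (i : ι) :
          Filter.Tendsto (fun ε => a i + ε * b i) (nhdsWithin 0 (Set.Ioi 0)) (nhds (a i)) :=
        (Continuous.tendsto' (by fun_prop) 0 _ (by simp)).mono_left nhdsWithin_le_nhds
      exact (tendsto_add i).eventually_lt (tendsto_add j) hlt
    · filter_upwards [self_mem_nhdsWithin] with ε hε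
      simpa only [heq, add_lt_add_iff_left] using mul_lt_mul_of_pos_left (hb hij heq) hε
  obtain ⟨ε, hlt, hε⟩ := (eventually_lt.and self_mem_nhdsWithin).exists
  exact ⟨ε, hε, fun i j hij => hlt (i, j) hij⟩

lemma exists_strictMono_comp_surjective {ι : Type*} [Finite ι] (x : ι → ℝ) :
    ∃ (m : ℕ) (f : ι → Fin m) (γ : Fin m → ℝ), Surjective f ∧ StrictMono γ ∧ γ ∘ f = x := by
  classical
  have := Fintype.ofFinite ι
  let e := (univ.image x).orderIsoOfFin rfl
  refine ⟨_, fun i => e.symm ⟨x i, mem_image_of_mem x (mem_univ i)⟩, fun p => e p,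
    fun p => ?_, e.strictMono, funext fun i => ?_⟩
  · obtain ⟨i, -, hi⟩ := mem_image.1 (e p).2
    exact ⟨i, e.symm_apply_eq.2 (Subtype.ext hi)⟩
  · simp only [comp_apply, OrderIso.apply_symm_apply]

end Order

section Slabs

open Classical in
lemma ite_exists_neg_add_ite_exists_pos {V : Set ℝ} (hV : IsOpen V) (hc : V.OrdConnected) :
    (if ∃ t ∈ V, t < 0 then 1 else 0) + (if ∃ t ∈ V, 0 < t then 1 else 0) =
      (if V.Nonempty then 1 else 0) + if (0 : ℝ) ∈ V then 1 else 0 := by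
  by_cases h0 : (0 : ℝ) ∈ V
  · obtain ⟨a, b, ⟨ha, hb⟩, hab⟩ := mem_nhds_iff_exists_Ioo_subset.1 (hV.mem_nhds h0)
    rw [if_pos ⟨a / 2, hab ⟨by linarith, by linarith⟩, by linarith⟩,
      if_pos ⟨b / 2, hab ⟨by linarith, by linarith⟩, by linarith⟩, if_pos ⟨0, h0⟩, if_pos h0]
  · have not_both : ¬ ((∃ t ∈ V, t < 0) ∧ ∃ t ∈ V, 0 < t) := fun ⟨⟨s, hs, hs0⟩, t, ht, ht0⟩ =>
      h0 (hc.out hs ht ⟨hs0.le, ht0.le⟩)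
    have nonempty_iff : V.Nonempty ↔ (∃ t ∈ V, t < 0) ∨ ∃ t ∈ V, 0 < t :=
      ⟨fun ⟨t, ht⟩ => (ne_of_mem_of_not_mem ht h0).lt_or_gt.imp (⟨t, ht, ·⟩) (⟨t, ht, ·⟩),
        fun h => h.elim (fun ⟨t, ht, _⟩ => ⟨t, ht⟩) fun ⟨t, ht, _⟩ => ⟨t, ht⟩⟩
    grind

variable {E : Type*} [AddCommGroup E] [TopologicalSpace E] [ContinuousAdd E] [Module ℝ E]
  [ContinuousSMul ℝ E] {k : ℕ}

open Classical in
lemma ite_exists_functional_neg_add_ite_exists_pos {U : Set E} (hU : IsOpen U) (hc : Convex ℝ U)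
    {l : StrongDual ℝ E} (hl : l ≠ 0) :
    (if ∃ x ∈ U, l x < 0 then 1 else 0) + (if ∃ x ∈ U, 0 < l x then 1 else 0) =
      (if U.Nonempty then 1 else 0) + if ∃ x ∈ U, l x = 0 then 1 else 0 := by
  have on_image := ite_exists_neg_add_ite_exists_pos (l.isOpenMap_of_ne_zero hl U hU)
    (hc.linear_image l.toLinearMap).ordConnected
  simp only [Set.exists_mem_image, Set.image_nonempty] at on_image
  exact on_image

open Classical in
lemma card_slabs_eq {U : Set E} (hU : IsOpen U) (hc : Convex ℝ U) {l : Fin k → StrongDual ℝ E}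
    (hl : ∀ i, l i ≠ 0) (hmono : ∀ x ∈ U, StrictMono (l · x)) :
    #{p : Fin (k + 1) | ∃ x ∈ U, (∀ i, i.castSucc < p → l i x < 0) ∧
        ∀ i, p ≤ i.castSucc → 0 < l i x} =
      (if U.Nonempty then 1 else 0) + #{i | ∃ x ∈ U, l i x = 0} := by
  induction k generalizing U with
  | zero => by_cases h : ∃ x, x ∈ U <;> simp [Set.Nonempty, h]
  | succ k ih =>
    have first_slab : (∃ x ∈ U, (∀ i : Fin (k + 1), i.castSucc < 0 → l i x < 0) ∧
        ∀ i : Fin (k + 1), 0 ≤ i.castSucc → 0 < l i x) ↔ ∃ x ∈ U, 0 < l 0 x :=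
      exists_congr fun x => and_congr_right fun hx => ⟨fun h => h.2 0 le_rfl, fun h =>
        ⟨fun i hi => (Fin.not_lt_zero _ hi).elim,
          fun i _ => h.trans_le ((hmono x hx).monotone i.zero_le)⟩⟩
    have later_slab (p : Fin (k + 1)) : (∃ x ∈ U, (∀ i, i.castSucc < p.succ → l i x < 0) ∧
        ∀ i, p.succ ≤ i.castSucc → 0 < l i x) ↔
        ∃ x ∈ U ∩ {x | l 0 x < 0}, (∀ i : Fin k, i.castSucc < p → l i.succ x < 0) ∧
          ∀ i : Fin k, p ≤ i.castSucc → 0 < l i.succ x := by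
      simp [Fin.forall_fin_succ, and_assoc, Fin.castSucc_lt_iff_succ_le, Fin.le_castSucc_iff]
    have later_wall (i : Fin k) : (∃ x ∈ U, l i.succ x = 0) ↔
        ∃ x ∈ U ∩ {x | l 0 x < 0}, l i.succ x = 0 :=
      ⟨fun ⟨x, hx, h⟩ => ⟨x, ⟨hx, h ▸ hmono x hx i.succ_pos⟩, h⟩, fun ⟨x, hx, h⟩ => ⟨x, hx.1, h⟩⟩
    have slabs_neg := ih (U := U ∩ {x | l 0 x < 0})
      (hU.inter (isOpen_lt (l 0).continuous continuous_const))
      (hc.inter (convex_halfSpace_lt (l 0).isLinear 0)) (fun i => hl i.succ)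
      fun x hx => (hmono x hx.1).comp Fin.strictMono_succ
    have neg_add_pos := ite_exists_functional_neg_add_ite_exists_pos hU hc (hl 0)
    simp only [card_filter] at slabs_neg ⊢
    rw [Fin.sum_univ_succ]
    conv_rhs => rw [Fin.sum_univ_succ]
    simp only [first_slab, later_slab, later_wall, slabs_neg]
    rw [← add_assoc, ← add_assoc, ← neg_add_pos, add_comm (ite _ _ _)]
    rfl

end Slabs

section BraidGeneric

open Module

/-- A subspace of `ℝ^ι` meets the flats of the braid arrangement as a generic subspace of
codimension `d` does. The flats of dimension `m` are the ranges of `LinearMap.funLeft ℝ ℝ f`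
for `f : ι → Fin m` surjective, so the intersections are recorded through their preimages. -/
def IsBraidGeneric {ι : Type*} (L : Submodule ℝ (ι → ℝ)) (d : ℕ) : Prop :=
  ∀ ⦃m : ℕ⦄ ⦃f : ι → Fin m⦄, Surjective f →
    finrank ℝ (L.comap (LinearMap.funLeft ℝ ℝ f)) = m - d

namespace IsBraidGeneric

variable {ι κ : Type*} {k d : ℕ}

lemma comap_funLeft {L : Submodule ℝ (ι → ℝ)} (hL : IsBraidGeneric L d) {g : ι → κ}
    (hg : Surjective g) : IsBraidGeneric (L.comap (LinearMap.funLeft ℝ ℝ g)) d := by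
  intro m f hf
  rw [← Submodule.comap_comp, ← LinearMap.funLeft_comp]
  exact hL (hf.comp hg)

lemma finrank_eq {L : Submodule ℝ (Fin k → ℝ)} (hL : IsBraidGeneric L d) :
    finrank ℝ L = k - d := by
  have := hL surjective_id
  rwa [show LinearMap.funLeft ℝ ℝ id = LinearMap.id from rfl, Submodule.comap_id] at this

lemma sup_range_funLeft_eq_top {L : Submodule ℝ (Fin k → ℝ)} (hL : IsBraidGeneric L d) {m : ℕ}
    {f : Fin k → Fin m} (hf : Surjective f) (hd : d ≤ m) :
    L ⊔ LinearMap.range (LinearMap.funLeft ℝ ℝ f) = ⊤ := by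
  have hinj := LinearMap.funLeft_injective_of_surjective ℝ ℝ f hf
  have finrank_inf : finrank ℝ ↥(L ⊓ LinearMap.range (LinearMap.funLeft ℝ ℝ f)) = m - d := by
    rw [inf_comm, ← Submodule.map_comap_eq,
      ← (Submodule.equivMapOfInjective _ hinj _).finrank_eq, hL hf]
  have finrank_range := LinearMap.finrank_range_of_inj hinj
  have finrank_sup_add := Submodule.finrank_sup_add_finrank_inf_eq L
    (LinearMap.range (LinearMap.funLeft ℝ ℝ f))
  have hm : m ≤ k := by simpa using Fintype.card_le_of_surjective f hf
  refine Submodule.eq_top_of_finrank_eq ?_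
  rw [hL.finrank_eq, finrank_inf, finrank_range, finrank_fin_fun] at finrank_sup_add
  rw [finrank_fin_fun]
  omega

lemma eq_zero_of_forall_succ_eq_zero {L : Submodule ℝ (Fin (k + 1) → ℝ)}
    (hL : IsBraidGeneric L d) (hd : 2 ≤ d) (hk : 1 ≤ k) {x : Fin (k + 1) → ℝ} (hx : x ∈ L)
    (h : ∀ i : Fin k, x i.succ = 0) : x = 0 := by
  let f : Fin (k + 1) → Fin 2 := Fin.cons 0 fun _ => 1
  have hf : Surjective f := by
    intro p
    fin_cases p
    exacts [⟨0, rfl⟩, ⟨Fin.succ ⟨0, hk⟩, rfl⟩]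
  have hx' : ![x 0, 0] ∘ f = x := by
    ext i
    cases i using Fin.cases <;> simp [f, h]
  have comap_eq_bot : L.comap (LinearMap.funLeft ℝ ℝ f) = ⊥ := by
    rw [← Submodule.finrank_eq_zero (R := ℝ), hL hf]
    omega
  have : ![x 0, 0] ∈ L.comap (LinearMap.funLeft ℝ ℝ f) := hx'.symm ▸ hx
  rw [comap_eq_bot, Submodule.mem_bot] at this
  rw [← hx', this, Pi.zero_comp]

lemma map_funLeft_succ {L : Submodule ℝ (Fin (k + 1) → ℝ)} (hL : IsBraidGeneric L (d + 1))
    (hd : 1 ≤ d) (hk : 1 ≤ k) : IsBraidGeneric (L.map (LinearMap.funLeft ℝ ℝ Fin.succ)) d := by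
  intro m f hf
  let f' : Fin (k + 1) → Fin (m + 1) := Fin.cons 0 (Fin.succ ∘ f)
  have hf' : Surjective f' := by
    intro p
    cases p using Fin.cases with
    | zero => exact ⟨0, rfl⟩
    | succ p => exact (hf p).imp' Fin.succ fun i hi => by simp [f', hi]
  have hm : 1 ≤ m := (f ⟨0, hk⟩).pos
  have comap_map_eq : (L.map (LinearMap.funLeft ℝ ℝ Fin.succ)).comap (LinearMap.funLeft ℝ ℝ f) =
      (L.comap (LinearMap.funLeft ℝ ℝ f')).map (LinearMap.funLeft ℝ ℝ Fin.succ) := by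
    ext γ
    constructor
    · rintro ⟨x, hx, hxγ⟩
      have cons_comp : LinearMap.funLeft ℝ ℝ f' (Fin.cons (x 0) γ : Fin (m + 1) → ℝ) = x := by
        ext i
        cases i using Fin.cases with
        | zero => rfl
        | succ i => exact (congrFun hxγ i).symm
      exact ⟨Fin.cons (x 0) γ, cons_comp.symm ▸ hx, rfl⟩
    · rintro ⟨γ', hγ', rfl⟩
      exact ⟨_, hγ', rfl⟩
  have injective_restrict : Injective
      ((LinearMap.funLeft ℝ ℝ Fin.succ).domRestrict (L.comap (LinearMap.funLeft ℝ ℝ f'))) := by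
    refine (injective_iff_map_eq_zero _).2 fun x hx => Subtype.ext ?_
    exact (hL.comap_funLeft hf').eq_zero_of_forall_succ_eq_zero (by omega) hm x.2 (congrFun hx)
  rw [comap_map_eq, ← LinearMap.range_domRestrict,
    LinearMap.finrank_range_of_inj injective_restrict, hL hf', Nat.add_sub_add_right]

end IsBraidGeneric

lemma range_funLeft_mem_arrangementLattice {n m : ℕ} (f : Fin n → Fin m) :
    LinearMap.range (LinearMap.funLeft ℝ ℝ f) ∈ arrangementLattice (reflectionArrangementA n) := by
  refine ⟨{H | ∃ i j, i < j ∧ f i = f j ∧ H = equalCoordHyperplane i j},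
    fun H ⟨i, j, hij, _, hH⟩ => ⟨i, j, hij, hH⟩, le_antisymm (le_sInf ?_) fun β hβ => ?_⟩
  · rintro _ ⟨i, j, -, hf, rfl⟩ _ ⟨γ, rfl⟩
    exact congrArg γ hf
  · have eq_of_lt {i j : Fin n} (hij : i < j) (hf : f i = f j) : β i = β j :=
      Submodule.mem_sInf.1 hβ _ ⟨i, j, hij, hf, rfl⟩
    have factors : β.FactorsThrough f := fun i j hf => by
      rcases lt_trichotomy i j with hij | rfl | hij
      exacts [eq_of_lt hij hf, rfl, (eq_of_lt hij hf.symm).symm]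
    exact ((factorsThrough_iff β).1 factors).imp fun γ h => h.symm

lemma InGeneralPosition.isBraidGeneric {n d : ℕ} {L : Submodule ℝ (Fin n → ℝ)}
    (hL : InGeneralPosition (reflectionArrangementA n) L d) : IsBraidGeneric L d := by
  intro m f hf
  have hinj := LinearMap.funLeft_injective_of_surjective ℝ ℝ f hf
  have finrank_range := LinearMap.finrank_range_of_inj hinj
  rw [finrank_fin_fun] at finrank_range
  rw [(Submodule.equivMapOfInjective _ hinj _).finrank_eq, Submodule.map_comap_eq, inf_comm]
  have inf_range := hL _ (range_funLeft_mem_arrangementLattice f)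
  rw [finrank_range] at inf_range
  rcases le_total d m with h | h
  · exact inf_range.1 h
  · rw [inf_range.2 h, Nat.sub_eq_zero_of_le h]

end BraidGeneric

section MetChambers

variable {k d : ℕ} {L : Submodule ℝ (Fin k → ℝ)}

namespace IsBraidGeneric

lemma exists_strictMono {m : ℕ} {f : Fin k → Fin m} {γ : Fin m → ℝ} (hL : IsBraidGeneric L d)
    (hf : Surjective f) (hd : d ≤ m) (hγ : StrictMono γ) (hγL : γ ∘ f ∈ L)
    (hmono : Monotone (γ ∘ f)) : ∃ β ∈ L, StrictMono β := by
  obtain ⟨l, hl, _, ⟨κ, rfl⟩, hsum⟩ := Submodule.mem_sup.1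
    (hL.sup_range_funLeft_eq_top hf hd ▸ Submodule.mem_top (x := fun i : Fin k => (i : ℝ)))
  have l_lt ⦃i j : Fin k⦄ (hij : i < j) (heq : (γ ∘ f) i = (γ ∘ f) j) : l i < l j := by
    have hi : l i + κ (f i) = i := congrFun hsum i
    have hj : l j + κ (f j) = j := congrFun hsum j
    rw [hγ.injective heq] at hi
    have : (i : ℝ) < j := by exact_mod_cast hij
    linarith
  obtain ⟨ε, -, hε⟩ := exists_pos_strictMono_add_smul hmono l_lt
  exact ⟨_, L.add_mem hγL (L.smul_mem ε hl), hε⟩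

lemma exists_strictMono_of_monotone {v : Fin k → ℝ} (hL : IsBraidGeneric L d) (hv : v ∈ L)
    (hv0 : v ≠ 0) (hmono : Monotone v) : ∃ β ∈ L, StrictMono β := by
  obtain ⟨m, f, γ, hf, hγ, rfl⟩ := exists_strictMono_comp_surjective v
  refine hL.exists_strictMono hf (le_of_not_gt fun hmd => hv0 ?_) hγ hv hmono
  have comap_eq_bot : L.comap (LinearMap.funLeft ℝ ℝ f) = ⊥ := by
    rw [← Submodule.finrank_eq_zero (R := ℝ), hL hf, Nat.sub_eq_zero_of_le hmd.le]
  have : γ ∈ L.comap (LinearMap.funLeft ℝ ℝ f) := hv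
  rw [comap_eq_bot, Submodule.mem_bot] at this
  rw [this, Pi.zero_comp]

end IsBraidGeneric

open Classical in
/-- The number of open Weyl chambers of type `A_{k-1}` that `L` meets; the chamber of `τ` is
`{β | β_{τ(1)} < ⋯ < β_{τ(k)}}`. -/
noncomputable def metChamberCount (L : Submodule ℝ (Fin k → ℝ)) : ℕ :=
  #{τ : Equiv.Perm (Fin k) | ∃ β ∈ L, StrictMono (β ∘ τ)}

lemma not_strictMono_zero (hk : 2 ≤ k) : ¬StrictMono (0 : Fin k → ℝ) := fun h =>
  (h (show (⟨0, by omega⟩ : Fin k) < ⟨1, hk⟩ from Nat.one_pos)).ne rfl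

lemma metChamberCount_bot (hk : 2 ≤ k) : metChamberCount (⊥ : Submodule ℝ (Fin k → ℝ)) = 0 := by
  simp only [metChamberCount, Submodule.mem_bot, exists_eq_left, card_eq_zero,
    filter_eq_empty_iff, mem_univ, forall_const]
  exact fun _ => not_strictMono_zero hk

lemma IsBraidGeneric.metChamberCount_eq_factorial (hL : IsBraidGeneric L d) (hd : d ≤ 1)
    (hk : 1 ≤ k) : metChamberCount L = k.factorial := by
  have meets_all (τ : Equiv.Perm (Fin k)) : ∃ β ∈ L, StrictMono (β ∘ τ) := by
    have surjective_zero : Surjective fun _ : Fin k => (0 : Fin 1) :=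
      fun p => ⟨⟨0, hk⟩, Subsingleton.elim _ _⟩
    obtain ⟨β, hβ, hmono⟩ := (hL.comap_funLeft τ.symm.surjective).exists_strictMono
      surjective_zero hd (Subsingleton.strictMono (0 : Fin 1 → ℝ)) (Submodule.zero_mem _)
      monotone_const
    refine ⟨β ∘ τ.symm, hβ, ?_⟩
    rwa [comp_assoc, Equiv.symm_comp_self]
  classical
  rw [metChamberCount, filter_true_of_mem fun τ _ => meets_all τ, card_univ, Fintype.card_perm,
    Fintype.card_fin]

lemma isOpen_setOf_strictMono {ι : Type*} [Preorder ι] [Finite ι] :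
    IsOpen {v : ι → ℝ | StrictMono v} := by
  simp only [StrictMono, Set.ofPred_forall]
  exact isOpen_iInter_of_finite fun i => isOpen_iInter_of_finite fun j =>
    isOpen_iInter_of_finite fun _ => isOpen_lt (continuous_apply i) (continuous_apply j)

lemma convex_setOf_strictMono {ι : Type*} [Preorder ι] : Convex ℝ {v : ι → ℝ | StrictMono v} := by
  simp only [StrictMono, Set.ofPred_forall]
  refine convex_iInter fun i => convex_iInter fun j => convex_iInter fun _ => ?_
  have sub_neg_iff (v : ι → ℝ) : v i < v j ↔ v i - v j < 0 := sub_neg.symm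
  simp only [sub_neg_iff]
  exact convex_halfSpace_lt
    (LinearMap.proj (R := ℝ) (φ := fun _ : ι => ℝ) i - LinearMap.proj j).isLinear 0

open Classical in
lemma card_insertNth_strictMono {L : Submodule ℝ (Fin (k + 1) → ℝ)}
    (hL : ∀ i : Fin k, ∃ β ∈ L, β i.succ ≠ β 0) (τ : Equiv.Perm (Fin k)) :
    #{p : Fin (k + 1) | ∃ β ∈ L,
        StrictMono (p.insertNth (β 0) fun i => β (τ i).succ : Fin (k + 1) → ℝ)} =
      (if ∃ β ∈ L, StrictMono fun i => β (τ i).succ then 1 else 0) +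
        #{i : Fin k | ∃ β ∈ L, (StrictMono fun i => β (τ i).succ) ∧ β i.succ = β 0} := by
  let tail : L →ₗ[ℝ] Fin k → ℝ := (LinearMap.funLeft ℝ ℝ fun i => (τ i).succ) ∘ₗ L.subtype
  let U : Set L := tail ⁻¹' {v | StrictMono v}
  have mem_U (x : L) : x ∈ U ↔ StrictMono fun i => x.1 (τ i).succ := Iff.rfl
  let l (i : Fin k) : StrongDual ℝ L := (ContinuousLinearMap.proj (τ i).succ -
    ContinuousLinearMap.proj (R := ℝ) (φ := fun _ => ℝ) 0).comp L.subtypeL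
  have l_apply (i : Fin k) (x : L) : l i x = x.1 (τ i).succ - x.1 0 := rfl
  have l_ne_zero (i : Fin k) : l i ≠ 0 := fun h => by
    obtain ⟨β, hβ, hne⟩ := hL (τ i)
    exact hne (sub_eq_zero.1 (DFunLike.congr_fun h ⟨β, hβ⟩))
  have slabs := card_slabs_eq (U := U)
    (isOpen_setOf_strictMono.preimage tail.continuous_of_finiteDimensional)
    (convex_setOf_strictMono.linear_preimage tail)
    l_ne_zero fun x hx i j hij => sub_lt_sub_right (hx hij) _
  have reindex : #{i | ∃ x ∈ U, l i x = 0} =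
      #{i : Fin k | ∃ β ∈ L, (StrictMono fun i => β (τ i).succ) ∧ β i.succ = β 0} := by
    refine card_equiv τ fun i => ?_
    simp only [l_apply, sub_eq_zero, mem_U, mem_filter_univ, Subtype.exists, exists_prop]
  simp only [Fin.strictMono_insertNth_iff]
  rw [← reindex]
  simpa only [l_apply, sub_neg, sub_pos, Set.Nonempty, mem_U, Subtype.exists, exists_prop]
    using slabs

/-- The permutation `σ` of `{0, …, k}` with `σ p = 0` that lists `1, …, k` in the order prescribed
by `τ`. -/
def insertPerm (p : Fin (k + 1)) (τ : Equiv.Perm (Fin k)) : Equiv.Perm (Fin (k + 1)) :=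
  (finSuccEquiv' p).trans (τ.optionCongr.trans (finSuccEquiv' 0).symm)

lemma insertPerm_self (p : Fin (k + 1)) (τ : Equiv.Perm (Fin k)) : insertPerm p τ p = 0 := by
  simp [insertPerm]

lemma insertPerm_succAbove (p : Fin (k + 1)) (τ : Equiv.Perm (Fin k)) (i : Fin k) :
    insertPerm p τ (p.succAbove i) = (τ i).succ := by
  simp [insertPerm]

lemma comp_insertPerm {X : Type*} (β : Fin (k + 1) → X) (p : Fin (k + 1))
    (τ : Equiv.Perm (Fin k)) :
    β ∘ insertPerm p τ = (p.insertNth (β 0) fun i => β (τ i).succ : Fin (k + 1) → X) :=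
  Fin.eq_insertNth_iff.2 ⟨congrArg β (insertPerm_self p τ),
    funext fun i => congrArg β (insertPerm_succAbove p τ i)⟩

lemma bijective_insertPerm : Bijective fun x : Fin (k + 1) × Equiv.Perm (Fin k) =>
    insertPerm x.1 x.2 := by
  refine (Fintype.bijective_iff_injective_and_card _).2 ⟨?_, ?_⟩
  · rintro ⟨p, τ⟩ ⟨q, ρ⟩ h
    obtain rfl : p = q := (insertPerm p τ).injective <| by
      rw [insertPerm_self, show insertPerm p τ = insertPerm q ρ from h, insertPerm_self]
    congr 1
    refine Equiv.ext fun i => Fin.succ_injective _ ?_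
    simpa only [insertPerm_succAbove] using DFunLike.congr_fun h (p.succAbove i)
  · simp [Fintype.card_perm, Nat.factorial_succ]

lemma funLeft_cons_comp_succ {i : Fin k} {β : Fin (k + 1) → ℝ} (h : β i.succ = β 0) :
    LinearMap.funLeft ℝ ℝ (Fin.cons i id) (β ∘ Fin.succ) = β := by
  ext j
  cases j using Fin.cases <;> simp [LinearMap.funLeft_apply, h]

lemma metChamberCount_succ_of_forall_exists_ne {L : Submodule ℝ (Fin (k + 1) → ℝ)}
    (hL : ∀ i : Fin k, ∃ β ∈ L, β i.succ ≠ β 0) :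
    metChamberCount L = metChamberCount (L.map (LinearMap.funLeft ℝ ℝ Fin.succ)) +
      ∑ i : Fin k, metChamberCount (L.comap (LinearMap.funLeft ℝ ℝ (Fin.cons i id))) := by
  classical
  have mem_comap (i : Fin k) (τ : Equiv.Perm (Fin k)) :
      (∃ γ ∈ L.comap (LinearMap.funLeft ℝ ℝ (Fin.cons i id)), StrictMono (γ ∘ τ)) ↔
        ∃ β ∈ L, (StrictMono fun j => β (τ j).succ) ∧ β i.succ = β 0 := by
    constructor
    · rintro ⟨γ, hγ, hmono⟩
      exact ⟨_, hγ, hmono, rfl⟩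
    · rintro ⟨β, hβ, hmono, heq⟩
      refine ⟨β ∘ Fin.succ, ?_, hmono⟩
      rwa [Submodule.mem_comap, funLeft_cons_comp_succ heq]
  have mem_map (τ : Equiv.Perm (Fin k)) :
      (∃ γ ∈ L.map (LinearMap.funLeft ℝ ℝ Fin.succ), StrictMono (γ ∘ τ)) ↔
        ∃ β ∈ L, StrictMono fun j => β (τ j).succ := by
    simp only [Submodule.mem_map, exists_exists_and_eq_and]
    rfl
  simp only [metChamberCount, mem_comap, mem_map, card_filter]
  rw [← bijective_insertPerm.sum_comp, Fintype.sum_prod_type, sum_comm,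
    sum_comm (s := univ (α := Fin k)), ← sum_add_distrib]
  refine sum_congr rfl fun τ _ => ?_
  simp only [comp_insertPerm, ← card_filter]
  exact card_insertNth_strictMono hL τ

lemma surjective_cons_id (i : Fin k) : Surjective (Fin.cons i id : Fin (k + 1) → Fin k) :=
  fun j => ⟨j.succ, rfl⟩

lemma IsBraidGeneric.metChamberCount_succ {L : Submodule ℝ (Fin (k + 1) → ℝ)}
    (hL : IsBraidGeneric L d) (hk : 2 ≤ k) :
    metChamberCount L = metChamberCount (L.map (LinearMap.funLeft ℝ ℝ Fin.succ)) +
      ∑ i : Fin k, metChamberCount (L.comap (LinearMap.funLeft ℝ ℝ (Fin.cons i id))) := by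
  rcases le_or_gt d k with hd | hd
  · refine metChamberCount_succ_of_forall_exists_ne fun i => ?_
    by_contra! heq
    have comap_le : L ≤ LinearMap.range (LinearMap.funLeft ℝ ℝ (Fin.cons i id : _ → Fin k)) :=
      fun β hβ => ⟨β ∘ Fin.succ, funLeft_cons_comp_succ (heq β hβ)⟩
    have finrank_comap := hL (surjective_cons_id i)
    rw [(Submodule.equivMapOfInjective _ (LinearMap.funLeft_injective_of_surjective ℝ ℝ _
      (surjective_cons_id i)) _).finrank_eq, Submodule.map_comap_eq, inf_eq_right.2 comap_le,
      hL.finrank_eq] at finrank_comap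
    omega
  · obtain rfl : L = ⊥ := by
      rw [← Submodule.finrank_eq_zero (R := ℝ), hL.finrank_eq, Nat.sub_eq_zero_of_le hd]
    have comap_bot (i : Fin k) : (⊥ : Submodule ℝ (Fin (k + 1) → ℝ)).comap
        (LinearMap.funLeft ℝ ℝ (Fin.cons i id : _ → Fin k)) = ⊥ :=
      LinearMap.ker_eq_bot.2 <|
        LinearMap.funLeft_injective_of_surjective _ _ _ (surjective_cons_id i)
    simp only [Submodule.map_bot, comap_bot, metChamberCount_bot hk,
      metChamberCount_bot (hk.trans k.le_succ), sum_const_zero, add_zero]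

end MetChambers

section Stirling

/-- The sum `[k, d-1] + [k, d-3] + ⋯` of unsigned Stirling numbers of the first kind. -/
def alternateStirlingSum (k d : ℕ) : ℕ :=
  ∑ j ∈ (range d).filter (fun j => Odd (d - j)), Nat.stirlingFirst k j

lemma alternateStirlingSum_of_le_one {k d : ℕ} (hk : 1 ≤ k) (hd : d ≤ 1) :
    alternateStirlingSum k d = 0 := by
  obtain ⟨k, rfl⟩ := Nat.exists_eq_add_of_le' hk
  interval_cases d <;> simp [alternateStirlingSum, sum_filter]

lemma alternateStirlingSum_zero_left (d : ℕ) :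
    alternateStirlingSum 0 d = if Odd d then 1 else 0 := by
  cases d with
  | zero => rfl
  | succ d => simp [alternateStirlingSum, sum_filter, sum_range_succ']

lemma alternateStirlingSum_succ_succ (k d : ℕ) : alternateStirlingSum (k + 1) (d + 1) =
    alternateStirlingSum k d + k * alternateStirlingSum k (d + 1) := by
  have mul_stirlingFirst_zero : k * Nat.stirlingFirst k 0 = 0 := by cases k <;> simp
  simp only [alternateStirlingSum, sum_filter, sum_range_succ', Nat.add_sub_add_right,
    Nat.stirlingFirst_succ_succ, Nat.stirlingFirst_succ_zero, ite_self, add_zero, mul_add, mul_sum,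
    mul_ite, mul_stirlingFirst_zero, mul_zero, ← sum_add_distrib]
  refine sum_congr rfl fun j _ => ?_
  split_ifs <;> ring

lemma alternateStirlingSum_two (d : ℕ) : alternateStirlingSum 2 (d + 2) = 1 := by
  simp only [alternateStirlingSum_succ_succ, alternateStirlingSum_zero_left, Nat.odd_add_one]
  split_ifs <;> simp

end Stirling

theorem IsBraidGeneric.metChamberCount_add_two_mul {k d : ℕ} {L : Submodule ℝ (Fin k → ℝ)}
    (hL : IsBraidGeneric L d) (hk : 2 ≤ k) :
    metChamberCount L + 2 * alternateStirlingSum k d = k.factorial := by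
  induction k, hk using Nat.le_induction generalizing d with
  | base =>
    rcases le_or_gt d 1 with hd | hd
    · rw [hL.metChamberCount_eq_factorial hd one_le_two,
        alternateStirlingSum_of_le_one one_le_two hd]
      rfl
    · obtain ⟨d, rfl⟩ := Nat.exists_eq_add_of_le' hd
      obtain rfl : L = ⊥ := by
        rw [← Submodule.finrank_eq_zero (R := ℝ), hL.finrank_eq, Nat.sub_eq_zero_of_le hd]
      rw [metChamberCount_bot le_rfl, alternateStirlingSum_two]
      rfl
  | succ k hk ih =>
    rcases le_or_gt d 1 with hd | hd
    · rw [hL.metChamberCount_eq_factorial hd (by omega),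
        alternateStirlingSum_of_le_one (by omega) hd, mul_zero, add_zero]
    · obtain ⟨d, rfl⟩ := Nat.exists_eq_add_of_le' hd
      have map_count := ih (hL.map_funLeft_succ (by omega) (by omega))
      have comap_count := sum_congr rfl fun i (_ : i ∈ univ) =>
        ih (hL.comap_funLeft (surjective_cons_id i))
      simp only [sum_add_distrib, sum_const, card_univ, Fintype.card_fin, smul_eq_mul]
        at comap_count
      rw [hL.metChamberCount_succ hk, alternateStirlingSum_succ_succ, Nat.factorial_succ]
      linarith

section MonotoneSurjections

lemma apply_zero_of_surjective_monotone {m l : ℕ} {g : Fin (m + 1) → Fin (l + 1)}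
    (hs : Surjective g) (hm : Monotone g) : g 0 = 0 :=
  let ⟨i, hi⟩ := hs 0
  Fin.le_zero_iff.1 (hi ▸ hm i.zero_le)

lemma surjective_cons_zero_iff {m l : ℕ} {h : Fin m → Fin (l + 1)} :
    Surjective (Fin.cons 0 h : Fin (m + 1) → Fin (l + 1)) ↔
      Surjective h ∨ ∃ h', Surjective h' ∧ Fin.succ ∘ h' = h := by
  constructor
  · intro hs
    have exists_succ (p : Fin l) : ∃ i, h i = p.succ := by
      obtain ⟨i, hi⟩ := hs p.succ
      cases i using Fin.cases with
      | zero => exact absurd hi.symm p.succ_ne_zero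
      | succ i => exact ⟨i, hi⟩
    by_cases h0 : ∃ i, h i = 0
    · exact Or.inl fun p => p.cases h0 exists_succ
    · rw [not_exists] at h0
      refine Or.inr ⟨fun i => (h i).pred (h0 i), fun p => ?_, funext fun i => Fin.succ_pred _ _⟩
      exact (exists_succ p).imp fun i hi => by simp only [hi, Fin.pred_succ]
  · rintro (hs | ⟨h', hs, rfl⟩) p
    · exact (hs p).imp' Fin.succ fun _ hi => hi
    · cases p using Fin.cases with
      | zero => exact ⟨0, rfl⟩
      | succ p => exact (hs p).imp' Fin.succ fun _ hi => congrArg Fin.succ hi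

lemma monotone_cons_zero_iff {m l : ℕ} {h : Fin m → Fin (l + 1)} :
    Monotone (Fin.cons 0 h : Fin (m + 1) → Fin (l + 1)) ↔ Monotone h := by
  refine ⟨fun hm => hm.comp Fin.strictMono_succ.monotone, fun hm i j hij => ?_⟩
  cases i using Fin.cases with
  | zero => exact Fin.zero_le _
  | succ i =>
    cases j using Fin.cases with
    | zero => exact absurd hij (not_le.2 i.succ_pos)
    | succ j => exact hm (Fin.succ_le_succ_iff.1 hij)

lemma setOf_surjective_monotone_succ (m l : ℕ) :
    {g : Fin (m + 2) → Fin (l + 1) | Surjective g ∧ Monotone g} =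
      Fin.cons 0 '' {h : Fin (m + 1) → Fin (l + 1) | Surjective h ∧ Monotone h} ∪
      (fun h => Fin.cons 0 (Fin.succ ∘ h)) ''
        {h : Fin (m + 1) → Fin l | Surjective h ∧ Monotone h} := by
  ext g
  constructor
  · rintro ⟨hs, hm⟩
    obtain ⟨h, rfl⟩ : ∃ h, Fin.cons 0 h = g :=
      ⟨Fin.tail g, apply_zero_of_surjective_monotone hs hm ▸ Fin.cons_self_tail g⟩
    rw [monotone_cons_zero_iff] at hm
    rcases surjective_cons_zero_iff.1 hs with hh | ⟨h, hh, rfl⟩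
    · exact Or.inl ⟨_, ⟨hh, hm⟩, rfl⟩
    · exact Or.inr ⟨h, ⟨hh, fun i j hij => Fin.succ_le_succ_iff.1 (hm hij)⟩, rfl⟩
  · rintro (⟨h, ⟨hs, hm⟩, rfl⟩ | ⟨h, ⟨hs, hm⟩, rfl⟩)
    · exact ⟨surjective_cons_zero_iff.2 (Or.inl hs), monotone_cons_zero_iff.2 hm⟩
    · exact ⟨surjective_cons_zero_iff.2 (Or.inr ⟨h, hs, rfl⟩),
        monotone_cons_zero_iff.2 (Fin.strictMono_succ.monotone.comp hm)⟩

lemma ncard_surjective_monotone (m l : ℕ) :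
    {g : Fin (m + 1) → Fin (l + 1) | Surjective g ∧ Monotone g}.ncard = m.choose l := by
  induction m generalizing l with
  | zero =>
    cases l with
    | zero =>
      have (g : Fin 1 → Fin 1) : Surjective g ∧ Monotone g :=
        ⟨fun _ => ⟨0, Subsingleton.elim _ _⟩, Subsingleton.monotone g⟩
      simp [this]
    | succ l =>
      have not_surjective (g : Fin 1 → Fin (l + 2)) : ¬Surjective g := fun hs =>
        absurd (Fintype.card_le_of_surjective g hs) (by simp)
      simp [not_surjective]
  | succ m ih =>
    have disjoint_images : Disjoint
        (Fin.cons 0 '' {h : Fin (m + 1) → Fin (l + 1) | Surjective h ∧ Monotone h})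
        ((fun h => Fin.cons (α := fun _ => Fin (l + 1)) 0 (Fin.succ ∘ h)) ''
          {h : Fin (m + 1) → Fin l | Surjective h ∧ Monotone h}) := by
      rw [Set.disjoint_left]
      rintro _ ⟨h, ⟨hs, -⟩, rfl⟩ ⟨h', -, heq⟩
      obtain ⟨i, hi⟩ := hs 0
      exact (h' i).succ_ne_zero ((congrFun (Fin.cons_right_injective _ heq) i).trans hi)
    have injective_cons_succ : Injective fun h : Fin (m + 1) → Fin l =>
        (Fin.cons 0 (Fin.succ ∘ h) : Fin (m + 2) → Fin (l + 1)) :=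
      (Fin.cons_right_injective _).comp (Fin.succ_injective _).comp_left
    rw [setOf_surjective_monotone_succ, Set.ncard_union_eq disjoint_images,
      Set.ncard_image_of_injective _ (Fin.cons_right_injective _),
      Set.ncard_image_of_injective _ injective_cons_succ, ih]
    cases l with
    | zero => rw [Set.eq_empty_of_isEmpty {g : Fin (m + 1) → Fin 0 | _}, Set.ncard_empty,
        Nat.choose_zero_right, Nat.choose_zero_right]
    | succ l => rw [ih, add_comm, Nat.choose_succ_succ]

end MonotoneSurjections

section Faces

open Module

variable {n k d : ℕ}

lemma span_weylChamberA_one :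
    Submodule.span ℝ (weylChamberA (1 : Equiv.Perm (Fin k)) : Set (Fin k → ℝ)) = ⊤ := by
  refine eq_top_iff.2 fun γ _ => ?_
  let a : Fin k → ℝ := fun p => ((p : ℕ) : ℝ)
  have strictMono_a : StrictMono a := fun p q hpq => Nat.cast_lt.2 hpq
  obtain ⟨ε, hε, strictMono_add⟩ := exists_pos_strictMono_add_smul (b := γ) strictMono_a.monotone
    fun p q hpq heq => absurd heq (strictMono_a hpq).ne
  have eq_smul_sub : γ = ε⁻¹ • (-a - -(a + ε • γ)) := by
    rw [neg_sub_neg, add_sub_cancel_left, inv_smul_smul₀ hε.ne']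
  rw [eq_smul_sub]
  exact Submodule.smul_mem _ _ (Submodule.sub_mem _
    (Submodule.subset_span fun _ _ h => neg_le_neg (strictMono_a.monotone h))
    (Submodule.subset_span fun _ _ h => neg_le_neg (strictMono_add.monotone h)))

/-- The cone of the vectors whose coordinates are constant on the fibres of `f` and decrease
weakly with the value of `f`. For `f` surjective with `f ∘ σ` monotone it is a `k`-dimensional
face of `weylChamberA σ`, and all faces arise in this way. -/
noncomputable def levelCone (f : Fin n → Fin k) : PointedCone ℝ (Fin n → ℝ) :=
  (weylChamberA (1 : Equiv.Perm (Fin k))).map (LinearMap.funLeft ℝ ℝ f)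

lemma mem_levelCone {f : Fin n → Fin k} {β : Fin n → ℝ} :
    β ∈ levelCone f ↔ ∃ γ : Fin k → ℝ, Antitone γ ∧ γ ∘ f = β := by
  rw [levelCone, PointedCone.mem_map]
  rfl

lemma mem_levelCone_iff {σ : Equiv.Perm (Fin n)} {f : Fin n → Fin k} {β : Fin n → ℝ}
    (hf : Surjective f) (hm : Monotone (f ∘ σ)) :
    β ∈ levelCone f ↔ β ∈ weylChamberA σ ∧ β.FactorsThrough f := by
  rw [mem_levelCone]
  constructor
  · rintro ⟨γ, hγ, rfl⟩
    exact ⟨fun i j hij => hγ (hm hij), fun i j h => congrArg γ h⟩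
  · rintro ⟨hβ, hβf⟩
    obtain ⟨γ, rfl⟩ := (factorsThrough_iff β).1 hβf
    refine ⟨γ, fun p q hpq => ?_, rfl⟩
    obtain ⟨i, rfl⟩ := hf.comp σ.surjective p
    obtain ⟨j, rfl⟩ := hf.comp σ.surjective q
    rcases hpq.eq_or_lt with heq | hlt
    · rw [heq]
    · exact hβ i j (hm.reflect_lt hlt).le

lemma finrank_span_levelCone {f : Fin n → Fin k} (hf : Surjective f) :
    finrank ℝ (Submodule.span ℝ (levelCone f : Set (Fin n → ℝ))) = k := by
  rw [levelCone, PointedCone.coe_map, Submodule.span_image, span_weylChamberA_one,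
    Submodule.map_top, LinearMap.finrank_range_of_inj
    (LinearMap.funLeft_injective_of_surjective _ _ _ hf), finrank_fin_fun]

lemma isFaceOf_levelCone {σ : Equiv.Perm (Fin n)} {f : Fin n → Fin k} (hf : Surjective f)
    (hm : Monotone (f ∘ σ)) : (levelCone f).IsFaceOf (weylChamberA σ) := by
  refine ⟨fun β hβ => ((mem_levelCone_iff hf hm).1 hβ).1, fun {x y a} hx hy ha hxy => ?_⟩
  refine (mem_levelCone_iff hf hm).2 ⟨hx, fun i j hij => ?_⟩
  obtain ⟨i, rfl⟩ := σ.surjective i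
  obtain ⟨j, rfl⟩ := σ.surjective j
  wlog hle : i ≤ j generalizing i j
  · exact (this j i hij.symm (le_of_not_ge hle)).symm
  have smul_add_eq : a * x (σ i) + y (σ i) = a * x (σ j) + y (σ j) :=
    ((mem_levelCone_iff hf hm).1 hxy).2 hij
  refine le_antisymm (le_of_mul_le_mul_left ?_ ha) (hx i j hle)
  linarith [hy i j hle]

lemma exists_mem_forall_eq_zero_of_nonneg {V ι : Type*} [AddCommGroup V] [Module ℝ V] [Finite ι]
    {F : PointedCone ℝ V} {φ : ι → V →ₗ[ℝ] ℝ} (hφ : ∀ p, ∀ x ∈ F, 0 ≤ φ p x) :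
    ∃ x ∈ F, ∀ p, φ p x = 0 → ∀ y ∈ F, φ p y = 0 := by
  have := Fintype.ofFinite ι
  have exists_witness (p : ι) : ∃ z ∈ F, φ p z = 0 → ∀ y ∈ F, φ p y = 0 := by
    by_contra! h
    obtain ⟨-, y, hy, hne⟩ := h 0 F.zero_mem
    exact hne (h y hy).1
  choose z hz hz0 using exists_witness
  refine ⟨∑ q, z q, Submodule.sum_mem _ fun q _ => hz q, fun p hp => hz0 p ?_⟩
  rw [map_sum] at hp
  exact (sum_eq_zero_iff_of_nonneg fun q _ => hφ p _ (hz q)).1 hp p (mem_univ p)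

lemma exists_mem_forall_factorsThrough {σ : Equiv.Perm (Fin n)} {F : PointedCone ℝ (Fin n → ℝ)}
    (hF : F ≤ weylChamberA σ) : ∃ x ∈ F, ∀ y ∈ F, y.FactorsThrough x := by
  let φ (p : {p : Fin n × Fin n // p.1 ≤ p.2}) : (Fin n → ℝ) →ₗ[ℝ] ℝ :=
    .proj (σ p.1.1) - .proj (σ p.1.2)
  obtain ⟨x, hx, hφx⟩ := exists_mem_forall_eq_zero_of_nonneg (φ := φ)
    fun p y hy => sub_nonneg.2 (hF hy _ _ p.2)
  refine ⟨x, hx, fun y hy i j hij => ?_⟩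
  obtain ⟨i, rfl⟩ := σ.surjective i
  obtain ⟨j, rfl⟩ := σ.surjective j
  wlog hle : i ≤ j generalizing i j
  · exact (this j i hij.symm (le_of_not_ge hle)).symm
  exact sub_eq_zero.1 (hφx ⟨(i, j), hle⟩ (sub_eq_zero.2 hij) y hy)

lemma exists_eq_levelCone {σ : Equiv.Perm (Fin n)} {F : PointedCone ℝ (Fin n → ℝ)}
    (hF : F.IsFaceOf (weylChamberA σ)) :
    ∃ (m : ℕ) (f : Fin n → Fin m), Surjective f ∧ Monotone (f ∘ σ) ∧ F = levelCone f := by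
  obtain ⟨x, hxF, hx⟩ := exists_mem_forall_factorsThrough hF.le
  obtain ⟨m, f, γ₀, hf, hγ₀, neg_eq⟩ := exists_strictMono_comp_surjective (-x)
  obtain rfl : x = (-γ₀) ∘ f := neg_eq_iff_eq_neg.1 neg_eq.symm
  have hm : Monotone (f ∘ σ) := fun i j hij =>
    hγ₀.le_iff_le.1 (neg_le_neg_iff.1 (hF.le hxF i j hij))
  refine ⟨m, f, hf, hm, le_antisymm (fun y hy => ?_) fun y hy => ?_⟩
  · exact (mem_levelCone_iff hf hm).2
      ⟨hF.le hy, fun i j hij => hx y hy (congrArg (-γ₀) hij)⟩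
  · obtain ⟨γ, -, rfl⟩ := mem_levelCone.1 hy
    obtain ⟨ε, hε, hmono⟩ := exists_pos_strictMono_add_smul (b := γ) hγ₀.monotone
      fun p q hpq heq => absurd heq (hγ₀ hpq).ne
    have sub_mem : (-γ₀) ∘ f - ε • (γ ∘ f) ∈ levelCone f :=
      mem_levelCone.2 ⟨-(γ₀ + ε • γ), hmono.monotone.neg, by rw [neg_add']; rfl⟩
    exact hF.mem_of_smul_add_mem ((mem_levelCone_iff hf hm).1 hy).1
      ((mem_levelCone_iff hf hm).1 sub_mem).1 hε (by rwa [add_sub_cancel])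

lemma facesOfDim_weylChamberA (σ : Equiv.Perm (Fin n)) :
    facesOfDim k (weylChamberA σ) =
      levelCone '' {f : Fin n → Fin k | Surjective f ∧ Monotone (f ∘ σ)} := by
  ext F
  constructor
  · rintro ⟨hF, hdim⟩
    obtain ⟨m, f, hf, hm, rfl⟩ := exists_eq_levelCone hF
    obtain rfl : m = k := (finrank_span_levelCone hf).symm.trans hdim
    exact ⟨f, ⟨hf, hm⟩, rfl⟩
  · rintro ⟨f, ⟨hf, hm⟩, rfl⟩
    exact ⟨isFaceOf_levelCone hf hm, finrank_span_levelCone hf⟩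

lemma le_of_levelCone_le {f g : Fin n → Fin k} (h : levelCone f ≤ levelCone g) {i j : Fin n}
    (hij : g i ≤ g j) : f i ≤ f j := by
  have : (fun p : Fin k => -((p : ℕ) : ℝ)) ∘ f ∈ levelCone g :=
    h (mem_levelCone.2 ⟨_, fun p q hpq => neg_le_neg (Nat.cast_le.2 hpq), rfl⟩)
  obtain ⟨γ, hγ, hγg⟩ := mem_levelCone.1 this
  have neg_le : -((f j : ℕ) : ℝ) ≤ -((f i : ℕ) : ℝ) :=
    (congrFun hγg j).symm.trans_le ((hγ hij).trans_eq (congrFun hγg i))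
  exact Nat.cast_le.1 (neg_le_neg_iff.1 neg_le)

lemma levelCone_injOn : Set.InjOn levelCone {f : Fin n → Fin k | Surjective f} := by
  intro f hf g _ h
  have strictMono_comp_surjInv : StrictMono (g ∘ surjInv hf) :=
    strictMono_of_le_iff_le fun p q => by
      nth_rw 1 [← surjInv_eq hf p, ← surjInv_eq hf q]
      exact ⟨le_of_levelCone_le h.ge, le_of_levelCone_le h.le⟩
  ext1 i
  calc f i = g (surjInv hf (f i)) := (congrFun strictMono_comp_surjInv.eq_id (f i)).symm
    _ = g i := le_antisymm (le_of_levelCone_le h.ge (surjInv_eq hf _).le)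
      (le_of_levelCone_le h.ge (surjInv_eq hf _).ge)

lemma ncard_facesOfDim_weylChamberA_inter_eq_zero (L : Submodule ℝ (Fin n → ℝ))
    (σ : Equiv.Perm (Fin n)) :
    {F ∈ facesOfDim k (weylChamberA σ) | (F : Set (Fin n → ℝ)) ∩ L = {0}}.ncard =
      {f : Fin n → Fin k | (Surjective f ∧ Monotone (f ∘ σ)) ∧
        (levelCone f : Set (Fin n → ℝ)) ∩ L = {0}}.ncard := by
  rw [facesOfDim_weylChamberA, ← (levelCone_injOn.mono fun f hf => hf.1.1).ncard_image]
  congr 1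
  ext F
  constructor
  · rintro ⟨⟨f, hf, rfl⟩, hL⟩
    exact ⟨f, ⟨hf, hL⟩, rfl⟩
  · rintro ⟨f, ⟨hf, hL⟩, rfl⟩
    exact ⟨⟨f, hf, rfl⟩, hL⟩

lemma levelCone_inter_eq_zero_iff {L : Submodule ℝ (Fin n → ℝ)} {f : Fin n → Fin k}
    (hf : Surjective f) (hL : IsBraidGeneric (L.comap (LinearMap.funLeft ℝ ℝ f)) d) (hk : 2 ≤ k) :
    (levelCone f : Set (Fin n → ℝ)) ∩ L = {0} ↔
      ¬∃ β ∈ L.comap (LinearMap.funLeft ℝ ℝ f), StrictMono β := by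
  constructor
  · rintro h ⟨β, hβL, hβ⟩
    have : (-β) ∘ f ∈ (levelCone f : Set (Fin n → ℝ)) ∩ L :=
      ⟨mem_levelCone.2 ⟨-β, hβ.monotone.neg, rfl⟩, L.neg_mem hβL⟩
    rw [h, Set.mem_singleton_iff] at this
    have hβ0 : -β = 0 := hf.injective_comp_right this
    exact not_strictMono_zero hk (neg_eq_zero.1 hβ0 ▸ hβ)
  · intro h
    refine Set.eq_singleton_iff_unique_mem.2 ⟨⟨zero_mem _, zero_mem _⟩, ?_⟩
    rintro _ ⟨hβ, hβL⟩
    obtain ⟨γ, hγ, rfl⟩ := mem_levelCone.1 hβ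
    by_contra! hne
    refine h (hL.exists_strictMono_of_monotone (v := -γ) (neg_mem hβL) ?_ hγ.neg)
    intro hγ0
    rw [neg_eq_zero.1 hγ0, Pi.zero_comp] at hne
    exact hne rfl

open Classical in
lemma card_levelCone_symm_comp_inter_eq_zero {L : Submodule ℝ (Fin n → ℝ)} {f : Fin n → Fin k}
    (hf : Surjective f) (hL : IsBraidGeneric L d) (hk : 2 ≤ k) :
    #{τ : Equiv.Perm (Fin k) | (levelCone (τ.symm ∘ f) : Set (Fin n → ℝ)) ∩ L = {0}} =
      2 * alternateStirlingSum k d := by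
  have inter_eq_zero_iff (τ : Equiv.Perm (Fin k)) :
      (levelCone (τ.symm ∘ f) : Set (Fin n → ℝ)) ∩ L = {0} ↔
        ¬∃ β ∈ L.comap (LinearMap.funLeft ℝ ℝ f), StrictMono (β ∘ τ) := by
    have hτf : Surjective (τ.symm ∘ f) := τ.symm.surjective.comp hf
    rw [levelCone_inter_eq_zero_iff hτf (hL.comap_funLeft hτf) hk, not_iff_not]
    constructor
    · rintro ⟨β, hβ, hmono⟩
      exact ⟨β ∘ τ.symm, hβ, by rwa [comp_assoc, Equiv.symm_comp_self]⟩
    · rintro ⟨β, hβ, hmono⟩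
      have comp_eq : (β ∘ τ) ∘ τ.symm ∘ f = β ∘ f := by
        rw [comp_assoc, ← comp_assoc τ, Equiv.self_comp_symm, id_comp]
      exact ⟨β ∘ τ, (congrArg (· ∈ L) comp_eq).mpr hβ, hmono⟩
  have card_add_card_not := card_filter_add_card_filter_not (s := univ)
    fun τ : Equiv.Perm (Fin k) => ∃ β ∈ L.comap (LinearMap.funLeft ℝ ℝ f), StrictMono (β ∘ τ)
  have count := (hL.comap_funLeft hf).metChamberCount_add_two_mul hk
  rw [card_univ, Fintype.card_perm, Fintype.card_fin, ← count, metChamberCount,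
    add_right_inj] at card_add_card_not
  simp only [inter_eq_zero_iff, card_add_card_not]

end Faces

section Averaging

lemma card_mul_sum_filter_eq_mul_sum {G X : Type*} [Fintype G] [Fintype X] {e : G → Equiv.Perm X}
    {w : X → ℕ} {P : X → Prop} [DecidablePred P] {N : ℕ} (hw : ∀ g x, w (e g x) = w x)
    (hP : ∀ x, w x ≠ 0 → #{g | P (e g x)} = N) :
    Fintype.card G * ∑ x with P x, w x = N * ∑ x, w x := by
  calc Fintype.card G * ∑ x with P x, w x = ∑ g : G, ∑ x, if P (e g x) then w x else 0 := by
        rw [← smul_eq_mul, ← card_univ, ← sum_const]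
        refine sum_congr rfl fun g _ => ?_
        rw [sum_filter, ← Equiv.sum_comp (e g)]
        simp only [hw]
    _ = ∑ x, #{g | P (e g x)} * w x := by
        rw [sum_comm]
        refine sum_congr rfl fun x _ => ?_
        rw [← sum_filter, sum_const, smul_eq_mul]
    _ = N * ∑ x, w x := by
        rw [mul_sum]
        refine sum_congr rfl fun x _ => ?_
        by_cases hx : w x = 0
        · rw [hx, mul_zero, mul_zero]
        · rw [hP x hx]

variable {n k d : ℕ}

lemma card_monotone_comp_perm (f : Fin n → Fin k) :
    #{σ : Equiv.Perm (Fin n) | Monotone (f ∘ σ)} = #{ρ : Equiv.Perm (Fin n) | f ∘ ρ = f} := by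
  refine card_equiv (Equiv.mulRight (Tuple.sort f)⁻¹) fun σ => ?_
  rw [mem_filter_univ, mem_filter_univ, ← Tuple.comp_sort_eq_comp_iff_monotone,
    Equiv.coe_mulRight, Equiv.Perm.coe_mul, ← comp_assoc]
  exact (Equiv.comp_symm_eq _ _ _).symm

lemma card_monotone_comp_perm_comp (τ : Equiv.Perm (Fin k)) (f : Fin n → Fin k) :
    #{σ : Equiv.Perm (Fin n) | Monotone ((τ ∘ f) ∘ σ)} =
      #{σ : Equiv.Perm (Fin n) | Monotone (f ∘ σ)} := by
  rw [card_monotone_comp_perm, card_monotone_comp_perm]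
  simp only [comp_assoc, τ.injective.comp_left.eq_iff]

lemma ncard_surjective_monotone_comp (hn : 1 ≤ n) (hk : 1 ≤ k) (σ : Equiv.Perm (Fin n)) :
    {f : Fin n → Fin k | Surjective f ∧ Monotone (f ∘ σ)}.ncard = (n - 1).choose (k - 1) := by
  obtain ⟨m, rfl⟩ := Nat.exists_eq_add_of_le' hn
  obtain ⟨l, rfl⟩ := Nat.exists_eq_add_of_le' hk
  rw [Nat.add_sub_cancel, Nat.add_sub_cancel, ← ncard_surjective_monotone]
  refine Set.ncard_congr (fun f _ => f ∘ σ) (fun f hf => ⟨hf.1.comp σ.surjective, hf.2⟩)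
    (fun f g _ _ h => σ.surjective.injective_comp_right h) fun g hg => ?_
  have comp_symm_comp : (g ∘ σ.symm) ∘ σ = g := by rw [comp_assoc, Equiv.symm_comp_self, comp_id]
  exact ⟨g ∘ σ.symm, ⟨hg.1.comp σ.symm.surjective, by rw [comp_symm_comp]; exact hg.2⟩,
    comp_symm_comp⟩

open Classical in
lemma sum_ncard_surjective_monotone_comp (P : (Fin n → Fin k) → Prop) :
    ∑ σ : Equiv.Perm (Fin n),
        {f : Fin n → Fin k | (Surjective f ∧ Monotone (f ∘ σ)) ∧ P f}.ncard =
      ∑ f with P f, #{σ : Equiv.Perm (Fin n) | Surjective f ∧ Monotone (f ∘ σ)} := by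
  refine Eq.trans (sum_congr rfl fun σ _ => ?_) (sum_card_bipartiteAbove_eq_sum_card_bipartiteBelow
    fun (σ : Equiv.Perm (Fin n)) (f : Fin n → Fin k) => Surjective f ∧ Monotone (f ∘ σ))
  rw [bipartiteAbove, filter_filter, ← Set.ncard_coe_finset, coe_filter_univ]
  simp only [and_comm]

lemma factorial_mul_sum_ncard_facesOfDim (hn : 1 ≤ n) (hk : 2 ≤ k)
    {L : Submodule ℝ (Fin n → ℝ)} (hL : IsBraidGeneric L d) :
    k.factorial * ∑ σ : Equiv.Perm (Fin n),
        {F ∈ facesOfDim k (weylChamberA σ) | (F : Set (Fin n → ℝ)) ∩ L = {0}}.ncard =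
      2 * alternateStirlingSum k d * (n.factorial * (n - 1).choose (k - 1)) := by
  classical
  let w (f : Fin n → Fin k) : ℕ := #{σ : Equiv.Perm (Fin n) | Surjective f ∧ Monotone (f ∘ σ)}
  let relabel (τ : Equiv.Perm (Fin k)) : Equiv.Perm (Fin n → Fin k) :=
    Equiv.piCongrRight fun _ => τ.symm
  have w_relabel (τ : Equiv.Perm (Fin k)) (f : Fin n → Fin k) : w (relabel τ f) = w f := by
    change #{σ : Equiv.Perm (Fin n) | Surjective (τ.symm ∘ f) ∧ Monotone ((τ.symm ∘ f) ∘ σ)} = w f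
    by_cases hf : Surjective f <;>
      simp only [w, Equiv.comp_surjective, hf, true_and, false_and, card_monotone_comp_perm_comp]
  have sum_w : ∑ f, w f = n.factorial * (n - 1).choose (k - 1) := by
    have := sum_ncard_surjective_monotone_comp (n := n) (k := k) fun _ => True
    simp only [and_true, ncard_surjective_monotone_comp hn (one_le_two.trans hk), sum_const,
      card_univ, Fintype.card_perm, Fintype.card_fin, smul_eq_mul, filter_true] at this
    exact this.symm
  have average := card_mul_sum_filter_eq_mul_sum (e := relabel) (w := w)
    (P := fun f => (levelCone f : Set (Fin n → ℝ)) ∩ L = {0})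
    (N := 2 * alternateStirlingSum k d) w_relabel fun f hwf => ?_
  · rw [sum_w, Fintype.card_perm, Fintype.card_fin] at average
    simp only [ncard_facesOfDim_weylChamberA_inter_eq_zero, sum_ncard_surjective_monotone_comp]
    exact average
  · obtain ⟨σ, hσ⟩ := card_ne_zero.1 hwf
    exact card_levelCone_symm_comp_inter_eq_zero (mem_filter.1 hσ).2.1 hL hk

end Averaging

theorem theorem2p6 (n d k : ℕ) (hn : 1 ≤ n) (hk : 2 ≤ k)
    (L : Submodule ℝ (Fin n → ℝ))
    (hcodim : Module.finrank ℝ ((Fin n → ℝ) ⧸ L) = d)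
    (hgen : InGeneralPosition (reflectionArrangementA n) L d) :
    (∀ σ : Equiv.Perm (Fin n), (facesOfDim k (weylChamberA σ)).Finite) ∧
    (1 / (n.factorial : ℝ)) * ∑ σ : Equiv.Perm (Fin n),
        (Set.ncard {F ∈ facesOfDim k (weylChamberA σ) |
          (F : Set (Fin n → ℝ)) ∩ (L : Set (Fin n → ℝ)) = {0}} : ℝ) =
      2 / (k.factorial : ℝ) * ((n - 1).choose (k - 1) : ℝ) *
        ∑ j ∈ (Finset.range d).filter (fun j => Odd (d - j)), (Nat.stirlingFirst k j : ℝ) := by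
  refine ⟨fun σ => ?_, ?_⟩
  · rw [facesOfDim_weylChamberA]
    exact (Set.toFinite _).image _
  · have count := congrArg (Nat.cast (R := ℝ))
      (factorial_mul_sum_ncard_facesOfDim hn hk hgen.isBraidGeneric)
    have n_factorial_ne_zero : (n.factorial : ℝ) ≠ 0 := mod_cast n.factorial_ne_zero
    have k_factorial_ne_zero : (k.factorial : ℝ) ≠ 0 := mod_cast k.factorial_ne_zero
    push_cast [alternateStirlingSum] at count
    field_simp
    linarith
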